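/- Let $k$ be a commutative domain and let $K$ be an abstract simplicial complex on vertices $x_1,\dots,x_n$ (the empty simplex is counted as a face). For a subcomplex $L\subseteq K$ let $I_L\subseteq k[x_1,\dots,x_n]$ be its face ideal, generated by the square-free monomials $\prod_{i\in s}x_i$ over all non-faces $s$ of $L$; let $R=k[x_1,\dots,x_n]/I_K$ be the Stanley--Reisner ring of $K$, and denote the image of $I_L$ in $R$ again by $I_L$. Let $D(R)=\bigcup_{m\ge 0}D^m(R)\subseteq \operatorname{End}_k(R)$ be the ring of $k$-linear differential operators on $R$, where $D^0(R)=R$ (acting by multiplication) and, for $m>0$, $D^m(R)=\{\varphi\in\operatorname{End}_k(R) : [\varphi,r]\in D^{m-1}(R)\text{ for all } r\in R\}$. **Theorem.** Let $\sigma$ be a face of $K$, let $x_\sigma=\prod_{x_i\in\sigma}x_i\in R$, and let $st(\sigma,K)=\{\tau\in K : \tau\cup\sigma\in K\}$ be the closed star of $\sigma$. Then the kernel of the localization map $D(R)\to D(R)[\tfrac1{x_\sigma}]$ (the localization of the ring $D(R)$ at the Ore set of powers of $x_\sigma$) is the extension $\overline{I_{st(\sigma,K)}}$ of the ideal $I_{st(\sigma,K)}\subseteq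 R$ to $D(R)$, that is, the two-sided ideal of $D(R)$ generated by $I_{st(\sigma,K)}$. -/

import Mathlib

noncomputable section

namespace StanleyReisner

/-! ### Simplicial complexes, stars and face rings

Mathlib's `PreAbstractSimplicialComplex` records only the nonempty faces of a complex; the empty
simplex is a face of every complex by convention. -/

/-- `σ` is a (possibly empty) face of `K`. -/
def IsFace {n : ℕ} (K : PreAbstractSimplicialComplex (Fin n)) (σ : Finset (Fin n)) : Prop :=
  σ = ∅ ∨ σ ∈ K

/-- The closed star `st(σ, K) = {τ ∈ K | τ ∪ σ ∈ K}`, a subcomplex of `K`. -/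
def star {n : ℕ} (σ : Finset (Fin n)) (K : PreAbstractSimplicialComplex (Fin n)) :
    PreAbstractSimplicialComplex (Fin n) where
  faces := {τ | τ ∈ K ∧ τ ∪ σ ∈ K}
  isRelLowerSet_faces := by
    rintro τ ⟨h₁, h₂⟩
    refine ⟨(K.isRelLowerSet_faces h₁).1, fun ρ hρ hne => ⟨?_, ?_⟩⟩
    · exact (K.isRelLowerSet_faces h₁).2 hρ hne
    · exact (K.isRelLowerSet_faces h₂).2 (Finset.union_subset_union_left hρ)
        (hne.mono Finset.subset_union_left)

/-- The face ideal `I_K ⊆ k[x_1, …, x_n]`, generated by the square-free monomials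
`∏_{i ∈ s} x_i` of the non-faces `s` of `K`. -/
def faceIdeal (k : Type*) [CommRing k] {n : ℕ} (K : PreAbstractSimplicialComplex (Fin n)) :
    Ideal (MvPolynomial (Fin n) k) :=
  Ideal.span {f | ∃ s : Finset (Fin n), ¬ IsFace K s ∧ f = ∏ i ∈ s, MvPolynomial.X i}

/-- The Stanley-Reisner ring (face ring) `R_K = k[x_1, …, x_n] / I_K`. -/
abbrev FaceRing (k : Type*) [CommRing k] {n : ℕ} (K : PreAbstractSimplicialComplex (Fin n)) :
    Type _ :=
  MvPolynomial (Fin n) k ⧸ faceIdeal k K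

/-- The monomial `x_σ = ∏_{i ∈ σ} x_i` in the face ring. -/
def faceMonomial (k : Type*) [CommRing k] {n : ℕ} (K : PreAbstractSimplicialComplex (Fin n))
    (σ : Finset (Fin n)) : FaceRing k K :=
  Ideal.Quotient.mk (faceIdeal k K) (∏ i ∈ σ, MvPolynomial.X i)

/-- The ideal `I_L` of a subcomplex `L ⊆ K`, as an ideal of the face ring `R_K`. -/
def subcomplexIdeal (k : Type*) [CommRing k] {n : ℕ} (K L : PreAbstractSimplicialComplex (Fin n)) :
    Ideal (FaceRing k K) :=
  (faceIdeal k L).map (Ideal.Quotient.mk (faceIdeal k K))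

/-! ### Rings of differential operators -/

/-- `D_k^m(A)`: `D_k^0(A)` consists of the multiplications by elements of `A`, and
`D_k^(m+1)(A)` of the `k`-linear endomorphisms `φ` of `A` with `[φ, a] ∈ D_k^m(A)` for all `a`. -/
def IsDiffOp (k A : Type*) [CommRing k] [CommRing A] [Algebra k A] : ℕ → Module.End k A → Prop
  | 0, φ => ∃ a : A, φ = Algebra.lmul k A a
  | m + 1, φ => ∀ a : A, IsDiffOp k A m (φ * Algebra.lmul k A a - Algebra.lmul k A a * φ)

section helpers

variable {k A : Type*} [CommRing k] [CommRing A] [Algebra k A]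

theorem IsDiffOp.lmul (m : ℕ) (a : A) : IsDiffOp k A m (Algebra.lmul k A a) := by
  induction m generalizing a with
  | zero => exact ⟨a, rfl⟩
  | succ m ih =>
    intro b
    rw [← map_mul, ← map_mul, ← map_sub, mul_comm a b, sub_self]
    exact ih 0

theorem IsDiffOp.succ {m : ℕ} {φ : Module.End k A} (h : IsDiffOp k A m φ) :
    IsDiffOp k A (m + 1) φ := by
  induction m generalizing φ with
  | zero =>
    obtain ⟨a, rfl⟩ := h
    exact IsDiffOp.lmul 1 a
  | succ m ih => exact fun a => ih (h a)

theorem IsDiffOp.mono {m m' : ℕ} (hm : m ≤ m') {φ : Module.End k A} (h : IsDiffOp k A m φ) :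
    IsDiffOp k A m' φ := by
  induction hm with
  | refl => exact h
  | step _ ih => exact ih.succ

theorem IsDiffOp.add {m : ℕ} {φ ψ : Module.End k A} (h : IsDiffOp k A m φ)
    (h' : IsDiffOp k A m ψ) : IsDiffOp k A m (φ + ψ) := by
  induction m generalizing φ ψ with
  | zero =>
    obtain ⟨a, rfl⟩ := h
    obtain ⟨b, rfl⟩ := h'
    exact ⟨a + b, (map_add _ a b).symm⟩
  | succ m ih =>
    intro a
    have e : (φ + ψ) * Algebra.lmul k A a - Algebra.lmul k A a * (φ + ψ)
        = (φ * Algebra.lmul k A a - Algebra.lmul k A a * φ)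
          + (ψ * Algebra.lmul k A a - Algebra.lmul k A a * ψ) := by
      ext x
      simp only [LinearMap.sub_apply, LinearMap.add_apply, Module.End.mul_apply, map_add]
      abel
    rw [e]
    exact ih (h a) (h' a)

theorem IsDiffOp.mul {m m' : ℕ} {φ ψ : Module.End k A} (h : IsDiffOp k A m φ)
    (h' : IsDiffOp k A m' ψ) : IsDiffOp k A (m + m') (φ * ψ) := by
  induction hN : m + m' generalizing m m' φ ψ with
  | zero =>
    obtain ⟨rfl, rfl⟩ : m = 0 ∧ m' = 0 := by omega
    obtain ⟨a, rfl⟩ := h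
    obtain ⟨b, rfl⟩ := h'
    exact ⟨a * b, (map_mul _ a b).symm⟩
  | succ N ih =>
    intro a
    have e : (φ * ψ) * Algebra.lmul k A a - Algebra.lmul k A a * (φ * ψ)
        = φ * (ψ * Algebra.lmul k A a - Algebra.lmul k A a * ψ)
          + (φ * Algebra.lmul k A a - Algebra.lmul k A a * φ) * ψ := by
      ext x
      simp
    rw [e]
    refine IsDiffOp.add ?_ ?_
    · cases m' with
      | zero =>
        obtain ⟨b, rfl⟩ := h'
        have e' : Algebra.lmul k A b * Algebra.lmul k A a
            - Algebra.lmul k A a * Algebra.lmul k A b = 0 := by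
          rw [← map_mul, ← map_mul, mul_comm, sub_self]
        rw [e', mul_zero, ← map_zero (Algebra.lmul k A)]
        exact IsDiffOp.lmul N 0
      | succ m' => exact ih h (h' a) (by omega)
    · cases m with
      | zero =>
        obtain ⟨b, rfl⟩ := h
        have e' : Algebra.lmul k A b * Algebra.lmul k A a
            - Algebra.lmul k A a * Algebra.lmul k A b = 0 := by
          rw [← map_mul, ← map_mul, mul_comm, sub_self]
        rw [e', zero_mul, ← map_zero (Algebra.lmul k A)]
        exact IsDiffOp.lmul N 0
      | succ m => exact ih (h a) h' (by omega)

end helpers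

/-- The ring `D_k(A) = ⋃ₘ D_k^m(A)` of `k`-linear differential operators on `A`. -/
def diffOp (k A : Type*) [CommRing k] [CommRing A] [Algebra k A] :
    Subring (Module.End k A) where
  carrier := {φ | ∃ m : ℕ, IsDiffOp k A m φ}
  mul_mem' := by
    rintro φ ψ ⟨m, h⟩ ⟨m', h'⟩
    exact ⟨m + m', h.mul h'⟩
  add_mem' := by
    rintro φ ψ ⟨m, h⟩ ⟨m', h'⟩
    exact ⟨max m m', (h.mono (le_max_left _ _)).add (h'.mono (le_max_right _ _))⟩
  one_mem' := ⟨0, 1, (map_one _).symm⟩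
  zero_mem' := ⟨0, 0, (map_zero _).symm⟩
  neg_mem' := by
    rintro φ ⟨m, h⟩
    refine ⟨0 + m, ?_⟩
    have e : -φ = Algebra.lmul k A (-1) * φ := by
      ext x
      simp
    rw [e]
    exact (IsDiffOp.lmul 0 (-1)).mul h

/-- The inclusion `A = D_k^0(A) → D_k(A)`, sending `a` to multiplication by `a`. -/
def toDiffOp (k : Type*) {A : Type*} [CommRing k] [CommRing A] [Algebra k A] :
    A →+* diffOp k A :=
  (Algebra.lmul k A).toRingHom.codRestrict (diffOp k A) fun a => ⟨0, a, rfl⟩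

/-- The extension to `D_k(A)` of an ideal `J` of `A`: the two-sided ideal generated by `J`. -/
def extension (k : Type*) {A : Type*} [CommRing k] [CommRing A] [Algebra k A] (J : Ideal A) :
    TwoSidedIdeal (diffOp k A) :=
  TwoSidedIdeal.span (toDiffOp k '' (J : Set A))

/-! ### Localization of `D_k(A)` at an element of `A`

The powers of `f ∈ A` form an Ore set in `D_k(A)`, since commutation with `f` lowers the order
of an operator. -/

section ore

variable {k A : Type*} [CommRing k] [CommRing A] [Algebra k A]

theorem exists_pow_mul_eq_zero (f : A) (m : ℕ) (φ : diffOp k A) (hφ : IsDiffOp k A m φ)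
    (h : φ * toDiffOp k f = 0) : ∃ N : ℕ, toDiffOp k f ^ N * φ = 0 := by
  induction m generalizing φ with
  | zero =>
    obtain ⟨a, ha⟩ := hφ
    obtain rfl : φ = toDiffOp k a := Subtype.ext ha
    refine ⟨1, ?_⟩
    rw [pow_one, ← map_mul, mul_comm, map_mul, h]
  | succ m ih =>
    obtain ⟨N, hN⟩ := ih (φ * toDiffOp k f - toDiffOp k f * φ) (hφ f)
      (by rw [h, zero_sub, neg_mul, mul_assoc, h, mul_zero, neg_zero])
    refine ⟨N + 1, ?_⟩
    rwa [h, zero_sub, mul_neg, neg_eq_zero, ← mul_assoc, ← pow_succ] at hN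

theorem exists_pow_mul_eq_mul (f : A) (m : ℕ) (φ : diffOp k A) (hφ : IsDiffOp k A m φ) :
    ∃ (N : ℕ) (ψ : diffOp k A), toDiffOp k f ^ N * φ = ψ * toDiffOp k f := by
  induction m generalizing φ with
  | zero =>
    obtain ⟨a, ha⟩ := hφ
    obtain rfl : φ = toDiffOp k a := Subtype.ext ha
    refine ⟨1, toDiffOp k a, ?_⟩
    rw [pow_one, ← map_mul, mul_comm, map_mul]
  | succ m ih =>
    obtain ⟨N, ψ, h⟩ := ih (φ * toDiffOp k f - toDiffOp k f * φ) (hφ f)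
    refine ⟨N + 1, toDiffOp k f ^ N * φ - ψ, ?_⟩
    rw [sub_mul, ← h, pow_succ]
    noncomm_ring

theorem nonempty_oreSet (f : A) :
    Nonempty (OreLocalization.OreSet (Submonoid.powers (toDiffOp k f))) := by
  have key : ∀ φ : diffOp k A, φ * toDiffOp k f = 0 → ∃ N : ℕ, toDiffOp k f ^ N * φ = 0 := by
    intro φ h
    obtain ⟨m, hφ⟩ := φ.2
    exact exists_pow_mul_eq_zero f m φ hφ h
  have key' : ∀ (j : ℕ) (φ : diffOp k A), φ * toDiffOp k f ^ j = 0 →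
      ∃ N : ℕ, toDiffOp k f ^ N * φ = 0 := by
    intro j
    induction j with
    | zero => exact fun φ h => ⟨0, by simpa using h⟩
    | succ j ih =>
      intro φ h
      rw [pow_succ, ← mul_assoc] at h
      obtain ⟨N, hN⟩ := key _ h
      rw [← mul_assoc] at hN
      obtain ⟨N', hN'⟩ := ih _ hN
      exact ⟨N' + N, by rw [pow_add, mul_assoc, hN']⟩
  have ore : ∀ φ : diffOp k A, ∃ (N : ℕ) (ψ : diffOp k A),
      toDiffOp k f ^ N * φ = ψ * toDiffOp k f := by
    intro φ
    obtain ⟨m, hφ⟩ := φ.2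
    exact exists_pow_mul_eq_mul f m φ hφ
  have ore' : ∀ (j : ℕ) (φ : diffOp k A), ∃ (N : ℕ) (ψ : diffOp k A),
      toDiffOp k f ^ N * φ = ψ * toDiffOp k f ^ j := by
    intro j
    induction j with
    | zero => exact fun φ => ⟨0, φ, by simp⟩
    | succ j ih =>
      intro φ
      obtain ⟨N, ψ, h⟩ := ih φ
      obtain ⟨N', ψ', h'⟩ := ore ψ
      exact ⟨N' + N, ψ', by rw [pow_add, mul_assoc, h, ← mul_assoc, h', mul_assoc, ← pow_succ']⟩
  refine OreLocalization.nonempty_oreSet_iff.mpr ⟨?_, ?_⟩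
  · rintro r₁ r₂ ⟨_, j, rfl⟩ h
    obtain ⟨N, hN⟩ := key' j (r₁ - r₂) (by rw [sub_mul]; exact sub_eq_zero.mpr h)
    exact ⟨⟨_, N, rfl⟩, by rw [mul_sub] at hN; exact sub_eq_zero.mp hN⟩
  · rintro r ⟨_, j, rfl⟩
    obtain ⟨N, ψ, h⟩ := ore' j r
    exact ⟨ψ, ⟨_, N, rfl⟩, h⟩

instance oreSetPowers (f : A) : OreLocalization.OreSet (Submonoid.powers (toDiffOp k f)) :=
  (nonempty_oreSet f).some

end ore

/-- The localization `D_k(A)[1/f]`: the ring of left fractions whose denominators are powers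
of `f ∈ A`. -/
abbrev Away (k : Type*) {A : Type*} [CommRing k] [CommRing A] [Algebra k A] (f : A) : Type _ :=
  OreLocalization (Submonoid.powers (toDiffOp k f)) (diffOp k A)

/-- The localization map `D_k(A) → D_k(A)[1/f]`. -/
def localizationMap (k : Type*) {A : Type*} [CommRing k] [CommRing A] [Algebra k A] (f : A) :
    diffOp k A →+* Away k f :=
  OreLocalization.numeratorRingHom

end StanleyReisner

end

noncomputable section

namespace StanleyReisner

open MvPolynomial

variable {k : Type*} [CommRing k] {n : ℕ}

/-! ### Divided power operators on the polynomial ring -/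

/-! An operator `φ` on `R = k[x]/I_K` has a finite Taylor expansion `∑ r_b ∂^(b)` in divided powers,
so no integer is ever inverted in `k`. Operators preserve the ideal `P_F` generated by the variables
outside a facet `F`, hence `r_b ∈ P_F` unless `supp b ⊆ F`. So each monomial `x^u` of `r_b`
satisfies: every face containing `supp u` spans a face together with `supp b`. This is the condition
under which `x^u ∂^(b)` preserves `I_K`, and so `φ` is a combination of monomial operators on `R`
itself.

If `φ` dies in the localization, a power of `x_σ` kills `φ`, hence every `r_b`, so `supp u ∪ σ` is a
non-face and `x_{supp u}` generates part of `I_{st(σ,K)}`. It remains to extract this factor from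
`x^u ∂^(b)` (`exists_mem_extension_isInducedBy`). When all exponents on `supp u` are at least 2,
split off `x_{supp u}`; the rest has the same support and still descends to `R`. An exponent 1 at
`i` is reached from larger exponents by composing with `x_i ∂_i^(2)` on the left (`monoOp_comp_eq`);
this uses that the extension is an ideal.

Conversely, `x_σ` annihilates `I_{st(σ,K)}` in `R` and becomes a unit in the localization. -/

/-- The product `∏ i, (u i).choose (b i)` of binomial coefficients. -/
def multiChoose {n : ℕ} (u b : Fin n →₀ ℕ) : ℕ := ∏ i, (u i).choose (b i)

theorem multiChoose_zero {n : ℕ} (u : Fin n →₀ ℕ) : multiChoose u 0 = 1 := by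
  simp [multiChoose]

theorem multiChoose_self {n : ℕ} (u : Fin n →₀ ℕ) : multiChoose u u = 1 := by
  simp [multiChoose]

/-- This makes the truncated subtraction `u - b` harmless: it only matters where the coefficient is
already zero. -/
theorem multiChoose_eq_zero {n : ℕ} {u b : Fin n →₀ ℕ} (h : ¬ b ≤ u) : multiChoose u b = 0 := by
  obtain ⟨i, hi⟩ : ∃ i, ¬ b i ≤ u i := by
    by_contra! hc
    exact h hc
  exact Finset.prod_eq_zero (Finset.mem_univ i) (Nat.choose_eq_zero_of_lt (by omega))

theorem multiChoose_eq_mul {n : ℕ} (u b : Fin n →₀ ℕ) (i : Fin n) :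
    multiChoose u b = (u i).choose (b i) * ∏ j ∈ Finset.univ.erase i, (u j).choose (b j) :=
  (Finset.mul_prod_erase _ _ (Finset.mem_univ i)).symm

theorem prod_erase_choose_congr {n : ℕ} {u u' b b' : Fin n →₀ ℕ} {i : Fin n}
    (hu : ∀ j, j ≠ i → u j = u' j) (hb : ∀ j, j ≠ i → b j = b' j) :
    ∏ j ∈ Finset.univ.erase i, (u j).choose (b j) =
      ∏ j ∈ Finset.univ.erase i, (u' j).choose (b' j) :=
  Finset.prod_congr rfl fun j hj => by
    rw [hu j (Finset.ne_of_mem_erase hj), hb j (Finset.ne_of_mem_erase hj)]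

theorem add_single_apply_of_ne {n : ℕ} (u : Fin n →₀ ℕ) {i j : Fin n} (m : ℕ) (h : j ≠ i) :
    (u + Finsupp.single i m) j = u j := by
  simp [h.symm]

theorem multiChoose_succ_succ {n : ℕ} (u b : Fin n →₀ ℕ) (i : Fin n) :
    multiChoose (u + Finsupp.single i 1) (b + Finsupp.single i 1) =
      multiChoose u (b + Finsupp.single i 1) + multiChoose u b := by
  have hu := fun j (h : j ≠ i) => add_single_apply_of_ne u 1 h
  have hb := fun j (h : j ≠ i) => add_single_apply_of_ne b 1 h
  rw [multiChoose_eq_mul _ _ i, multiChoose_eq_mul u (b + _) i, multiChoose_eq_mul u b i,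
    prod_erase_choose_congr hu hb, prod_erase_choose_congr (fun _ _ => rfl) hb, ← add_mul]
  congr 1
  simp only [Finsupp.add_apply, Finsupp.single_eq_same]
  rw [Nat.choose_succ_succ, add_comm]

theorem multiChoose_succ_of_eq_zero {n : ℕ} (u : Fin n →₀ ℕ) {b : Fin n →₀ ℕ} {i : Fin n}
    (h : b i = 0) : multiChoose (u + Finsupp.single i 1) b = multiChoose u b := by
  rw [multiChoose_eq_mul _ _ i, multiChoose_eq_mul u b i,
    prod_erase_choose_congr (fun j h => add_single_apply_of_ne u 1 h) (fun _ _ => rfl), h]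
  simp

/-- The operator `x^p ∂^(b)` on the polynomial ring, where `∂^(b)` is the divided power of the
partial derivatives: it maps `x^u` to `binom(u, b) x^(u - b + p)`. -/
def monoOp (k : Type*) [CommRing k] {n : ℕ} (p b : Fin n →₀ ℕ) :
    Module.End k (MvPolynomial (Fin n) k) :=
  (basisMonomials (Fin n) k).constr k fun u => monomial (u - b + p) (multiChoose u b : k)

theorem monoOp_monomial (p b u : Fin n →₀ ℕ) (c : k) :
    monoOp k p b (monomial u c) = monomial (u - b + p) (multiChoose u b * c) := by
  have h : monomial u c = c • (basisMonomials (Fin n) k) u := by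
    simp [smul_monomial]
  rw [h, map_smul, monoOp, Module.Basis.constr_basis, smul_monomial, smul_eq_mul, mul_comm]

theorem monoOp_zero_right (p : Fin n →₀ ℕ) (f : MvPolynomial (Fin n) k) :
    monoOp k p 0 f = monomial p 1 * f := by
  induction f using MvPolynomial.induction_on' with
  | monomial u c => simp [monoOp_monomial, multiChoose_zero, monomial_mul, add_comm]
  | add f g hf hg => rw [map_add, hf, hg, mul_add]

theorem monoOp_add_left (q p b : Fin n →₀ ℕ) (f : MvPolynomial (Fin n) k) :
    monoOp k (q + p) b f = monomial q 1 * monoOp k p b f := by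
  induction f using MvPolynomial.induction_on' with
  | monomial u c =>
    rw [monoOp_monomial, monoOp_monomial, monomial_mul, one_mul, add_left_comm]
  | add f g hf hg => rw [map_add, map_add, hf, hg, mul_add]

theorem monoOp_X_mul_of_eq_zero (p : Fin n →₀ ℕ) {b : Fin n →₀ ℕ} {i : Fin n} (h : b i = 0)
    (f : MvPolynomial (Fin n) k) :
    monoOp k p b (X i * f) = X i * monoOp k p b f := by
  induction f using MvPolynomial.induction_on' with
  | monomial u c =>
    rw [X, monomial_mul, one_mul, monoOp_monomial, monoOp_monomial, monomial_mul, one_mul,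
      add_comm _ u, multiChoose_succ_of_eq_zero u h]
    congr 2
    ext j
    rcases eq_or_ne j i with rfl | hj
    · simp [h]; omega
    · simp [hj.symm]
  | add f g hf hg => rw [mul_add, map_add, map_add, hf, hg, mul_add]

/-- Pascal's rule in the form `[x^p ∂^(b+e_i), x_i] = x^p ∂^(b)`. -/
theorem monoOp_X_mul (p b : Fin n →₀ ℕ) (i : Fin n) (f : MvPolynomial (Fin n) k) :
    monoOp k p (b + Finsupp.single i 1) (X i * f) =
      X i * monoOp k p (b + Finsupp.single i 1) f + monoOp k p b f := by
  induction f using MvPolynomial.induction_on' with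
  | monomial u c =>
    rw [X, monomial_mul, one_mul, monoOp_monomial, monoOp_monomial, monomial_mul, one_mul,
      add_comm _ u, multiChoose_succ_succ u b, monoOp_monomial, add_tsub_add_eq_tsub_right]
    push_cast
    rw [add_mul, map_add]
    congr 1
    by_cases h : b + Finsupp.single i 1 ≤ u
    · congr 2
      have := h i
      ext j
      rcases eq_or_ne j i with rfl | hj
      · simp at this ⊢; omega
      · simp [hj.symm]
    · simp [multiChoose_eq_zero h]
  | add f g hf hg => rw [mul_add, map_add, map_add, map_add, hf, hg, mul_add]; abel

/-! ### Reaching an exponent 1 from larger exponents -/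

/-- Put `m = u - b`, expand `C(m+2,2) = C(m,2) + 2m + 1`, and absorb each term into `C(u,b)`. For `u
< b` every term vanishes. -/
theorem choose_mul_choose_sub_two (u b : ℕ) :
    u.choose b * (u - b + 2).choose 2 =
      (b + 2).choose 2 * u.choose (b + 2) + 2 * (b + 1) * u.choose (b + 1) + u.choose b := by
  rcases lt_or_ge u b with h | h
  · rw [Nat.choose_eq_zero_of_lt h, Nat.choose_eq_zero_of_lt (by omega : u < b + 2),
      Nat.choose_eq_zero_of_lt (by omega : u < b + 1)]
    simp
  · obtain ⟨m, rfl⟩ := Nat.exists_eq_add_of_le h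
    have h1 : (b + m).choose (b + 1) * (b + 1) = (b + m).choose b * m := by
      have := Nat.choose_succ_right_eq (b + m) b
      rwa [Nat.add_sub_cancel_left] at this
    have h2 : (b + m).choose (b + 2) * (b + 2).choose 2 = (b + m).choose b * m.choose 2 := by
      rcases lt_or_ge m 2 with hm | hm
      · rw [Nat.choose_eq_zero_of_lt (by omega : b + m < b + 2), Nat.choose_eq_zero_of_lt hm]
        simp
      · have := Nat.choose_mul (n := b + m) (k := b + 2) (s := b) (by omega)
        rw [Nat.add_sub_cancel_left, Nat.add_sub_cancel_left] at this
        rw [← this, Nat.choose_symm_add]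
    have h3 : (m + 2).choose 2 = m.choose 2 + 2 * m + 1 := by
      simp [Nat.choose_succ_succ, Nat.choose_one_right]
      ring
    rw [Nat.add_sub_cancel_left, h3]
    nlinarith [h1, h2]

theorem multiChoose_mul_choose (u b : Fin n →₀ ℕ) (i : Fin n) :
    multiChoose u b * (u i - b i + 2).choose 2 =
      (b i + 2).choose 2 * multiChoose u (b + Finsupp.single i 2) +
        2 * (b i + 1) * multiChoose u (b + Finsupp.single i 1) + multiChoose u b := by
  rw [multiChoose_eq_mul u (b + Finsupp.single i 2) i,
    multiChoose_eq_mul u (b + Finsupp.single i 1) i, multiChoose_eq_mul u b i,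
    prod_erase_choose_congr (fun _ _ => rfl) (fun j h => add_single_apply_of_ne b 2 h),
    prod_erase_choose_congr (fun _ _ => rfl) (fun j h => add_single_apply_of_ne b 1 h)]
  have := choose_mul_choose_sub_two (u i) (b i)
  simp only [Finsupp.add_apply, Finsupp.single_eq_same]
  linear_combination (∏ j ∈ Finset.univ.erase i, (u j).choose (b j)) * this

theorem multiChoose_single (u : Fin n →₀ ℕ) (i : Fin n) (m : ℕ) :
    multiChoose u (Finsupp.single i m) = (u i).choose m := by
  rw [multiChoose_eq_mul _ _ i, Finset.prod_eq_one, mul_one, Finsupp.single_eq_same]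
  intro j hj
  simp [(Finset.ne_of_mem_erase hj).symm]

/-- Every term sends `x^u` to a multiple of `x^(u-b+p)`, so only binomial coefficients are compared.
The point is that `x^p ∂^(b)` occurs with coefficient 1, while all other operators with symbol
exponent from `p` have exponent at least 2 at `i`. -/
theorem monoOp_comp_eq (p b : Fin n →₀ ℕ) {i : Fin n} (hp : p i = 1)
    (f : MvPolynomial (Fin n) k) :
    monoOp k (Finsupp.single i 1) (Finsupp.single i 2)
        (monoOp k (p + Finsupp.single i 1) b f) =
      ((b i + 2).choose 2) • monoOp k (p + Finsupp.single i 2) (b + Finsupp.single i 2) f +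
      (2 * (b i + 1)) • monoOp k (p + Finsupp.single i 1) (b + Finsupp.single i 1) f +
      monoOp k p b f := by
  induction f using MvPolynomial.induction_on' with
  | monomial u c =>
    have e0 : u - b + (p + Finsupp.single i 1) - Finsupp.single i 2 + Finsupp.single i 1 =
        u - b + p := by
      ext j
      rcases eq_or_ne j i with rfl | hj
      · simp [hp]
      · simp [hj.symm]
    have key (m : ℕ) : monomial (u - (b + Finsupp.single i m) + (p + Finsupp.single i m))
        (multiChoose u (b + Finsupp.single i m) * c : k) =
        monomial (u - b + p) (multiChoose u (b + Finsupp.single i m) * c) := by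
      by_cases h : b + Finsupp.single i m ≤ u
      · congr 2
        have := h i
        ext j
        rcases eq_or_ne j i with rfl | hj
        · simp at this ⊢; omega
        · simp [hj.symm]
      · simp [multiChoose_eq_zero h]
    simp only [monoOp_monomial, key, e0, multiChoose_single]
    rw [← map_nsmul, ← map_nsmul, ← map_add, ← map_add]
    congr 1
    have h := congrArg (fun z : ℕ => (z : k)) (multiChoose_mul_choose u b i)
    have e : (u - b + (p + Finsupp.single i 1) : Fin n →₀ ℕ) i = u i - b i + 2 := by
      simp [hp]
    rw [e]
    push_cast at h
    simp only [nsmul_eq_mul]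
    push_cast
    linear_combination c * h
  | add f g hf hg => simp only [map_add, hf, hg, smul_add]; abel

/-! ### Differential operators on quotients of the polynomial ring -/

section quotient

variable {I : Ideal (MvPolynomial (Fin n) k)}

/-- An endomorphism of a quotient of the polynomial ring has order at most `m + 1` if its
commutators with the variables have order at most `m`. -/
theorem isDiffOp_succ_of_X {m : ℕ} {φ : Module.End k (MvPolynomial (Fin n) k ⧸ I)}
    (h : ∀ i, IsDiffOp k _ m (φ * Algebra.lmul k _ (Ideal.Quotient.mk I (X i)) -
      Algebra.lmul k _ (Ideal.Quotient.mk I (X i)) * φ)) : IsDiffOp k _ (m + 1) φ := by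
  intro a
  obtain ⟨f, rfl⟩ := Ideal.Quotient.mk_surjective a
  induction f using MvPolynomial.induction_on with
  | C c =>
    convert IsDiffOp.lmul (k := k) m (0 : MvPolynomial (Fin n) k ⧸ I) using 1
    refine LinearMap.ext fun x => ?_
    have : Ideal.Quotient.mk I (C c) = algebraMap k (MvPolynomial (Fin n) k ⧸ I) c := rfl
    simp [this, ← Algebra.smul_def]
  | add f g hf hg =>
    convert hf.add hg using 1
    simp only [map_add, mul_add, add_mul]
    abel
  | mul_X f i hf =>
    -- Leibniz rule: `[φ, f x_i] = [φ, f] x_i + f [φ, x_i]`.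
    have h1 := hf.mul (IsDiffOp.lmul 0 (Ideal.Quotient.mk I (X i)))
    have h2 := (IsDiffOp.lmul 0 (Ideal.Quotient.mk I f)).mul (h i)
    rw [zero_add] at h2
    rw [add_zero] at h1
    convert h1.add h2 using 1
    rw [map_mul, map_mul]
    generalize Algebra.lmul k _ (Ideal.Quotient.mk I f) = a
    generalize Algebra.lmul k _ (Ideal.Quotient.mk I (X i)) = b
    rw [sub_mul, mul_sub]
    simp only [mul_assoc]
    abel

/-- `φ` is induced by the endomorphism `θ` of the polynomial ring. -/
def IsInducedBy (φ : Module.End k (MvPolynomial (Fin n) k ⧸ I))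
    (θ : Module.End k (MvPolynomial (Fin n) k)) : Prop :=
  ∀ f, φ (Ideal.Quotient.mk I f) = Ideal.Quotient.mk I (θ f)

theorem exists_isInducedBy {θ : Module.End k (MvPolynomial (Fin n) k)}
    (h : ∀ f ∈ I, θ f ∈ I) : ∃ φ : Module.End k (MvPolynomial (Fin n) k ⧸ I), IsInducedBy φ θ :=
  ⟨Submodule.mapQ (I.restrictScalars k) (I.restrictScalars k) θ h, fun _ => rfl⟩

/-- The commutator with `x_i` is zero or is induced by `x^p ∂^(b-e_i)`, so the degree of `b` drops.
-/
theorem IsInducedBy.isDiffOp {p b : Fin n →₀ ℕ}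
    {φ : Module.End k (MvPolynomial (Fin n) k ⧸ I)} (h : IsInducedBy φ (monoOp k p b)) :
    IsDiffOp k _ b.degree φ := by
  induction hm : b.degree generalizing b φ with
  | zero =>
    obtain rfl : b = 0 := (Finsupp.degree_eq_zero_iff b).1 hm
    refine ⟨Ideal.Quotient.mk I (monomial p 1), LinearMap.ext fun x => ?_⟩
    obtain ⟨f, rfl⟩ := Ideal.Quotient.mk_surjective x
    rw [h, monoOp_zero_right]
    simp
  | succ m ih =>
    refine isDiffOp_succ_of_X fun i => ?_
    by_cases hi : b i = 0
    · convert IsDiffOp.lmul (k := k) m (0 : MvPolynomial (Fin n) k ⧸ I) using 1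
      refine LinearMap.ext fun x => ?_
      obtain ⟨f, rfl⟩ := Ideal.Quotient.mk_surjective x
      simp [← map_mul, h _, monoOp_X_mul_of_eq_zero p hi]
    · obtain ⟨b, rfl⟩ : ∃ b', b = b' + Finsupp.single i 1 :=
        ⟨b - Finsupp.single i 1, (tsub_add_cancel_of_le (by
          rw [Finsupp.single_le_iff]; omega)).symm⟩
      refine ih (b := b) (fun f => ?_) (by simpa using hm)
      simp [← map_mul, h _, monoOp_X_mul]

/-! ### Taylor expansion of endomorphisms of a quotient -/

/-- The Taylor coefficients of an endomorphism of a quotient of the polynomial ring, so that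
`φ = ∑ b, taylorCoeff φ b * ∂^(b)`. -/
def taylorCoeff (φ : Module.End k (MvPolynomial (Fin n) k ⧸ I)) (b : Fin n →₀ ℕ) :
    MvPolynomial (Fin n) k ⧸ I :=
  φ (Ideal.Quotient.mk I (monomial b 1)) - ∑ c : Finset.Iio b,
    multiChoose b c • (Ideal.Quotient.mk I (monomial (b - c.1) 1) * taylorCoeff φ c.1)
termination_by b.degree
decreasing_by
  have h := Finset.mem_Iio.1 c.2
  have h' := Finsupp.degree_mono h.le
  refine lt_of_le_of_ne h' fun e => h.ne ?_
  have := tsub_add_cancel_of_le h.le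
  have h0 : (b - c.1).degree = 0 := by
    have := congrArg Finsupp.degree this
    rw [map_add] at this
    omega
  rw [Finsupp.degree_eq_zero_iff] at h0
  rw [h0, zero_add] at this
  exact this

theorem taylorCoeff_eq (φ : Module.End k (MvPolynomial (Fin n) k ⧸ I)) (b : Fin n →₀ ℕ) :
    taylorCoeff φ b = φ (Ideal.Quotient.mk I (monomial b 1)) - ∑ c ∈ Finset.Iio b,
      multiChoose b c • (Ideal.Quotient.mk I (monomial (b - c) 1) * taylorCoeff φ c) := by
  rw [taylorCoeff]
  congr 1
  exact Finset.sum_coe_sort (Finset.Iio b) fun c =>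
    multiChoose b c • (Ideal.Quotient.mk I (monomial (b - c) 1) * taylorCoeff φ c)

theorem sum_Iic_eq {M : Type*} [AddCommMonoid M] (u : Fin n →₀ ℕ) (g : (Fin n →₀ ℕ) → M) :
    ∑ c ∈ Finset.Iic u, g c = g u + ∑ c ∈ Finset.Iio u, g c := by
  rw [← Finset.Iio_insert, Finset.sum_insert (by simp)]

theorem apply_monomial_eq_sum (φ : Module.End k (MvPolynomial (Fin n) k ⧸ I))
    (u : Fin n →₀ ℕ) :
    φ (Ideal.Quotient.mk I (monomial u 1)) = ∑ c ∈ Finset.Iic u,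
      multiChoose u c • (Ideal.Quotient.mk I (monomial (u - c) 1) * taylorCoeff φ c) := by
  rw [sum_Iic_eq, multiChoose_self, tsub_self, one_smul, taylorCoeff_eq φ u]
  rw [monomial_zero', C_1, map_one (Ideal.Quotient.mk I), one_mul, sub_add_cancel]

/-- The system is unitriangular: the coefficient of `s u` in the equation for `x^u` is 1. -/
theorem taylorCoeff_unique {φ : Module.End k (MvPolynomial (Fin n) k ⧸ I)}
    {s : (Fin n →₀ ℕ) → MvPolynomial (Fin n) k ⧸ I}
    (h : ∀ u, φ (Ideal.Quotient.mk I (monomial u 1)) = ∑ c ∈ Finset.Iic u,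
      multiChoose u c • (Ideal.Quotient.mk I (monomial (u - c) 1) * s c))
    (b : Fin n →₀ ℕ) : taylorCoeff φ b = s b := by
  induction b using WellFoundedLT.induction with
  | ind b ih =>
    rw [taylorCoeff_eq, h, sum_Iic_eq, multiChoose_self, tsub_self, one_smul]
    rw [monomial_zero', C_1, map_one (Ideal.Quotient.mk I), one_mul, add_sub_assoc, add_eq_left, sub_eq_zero]
    exact Finset.sum_congr rfl fun c hc => by rw [ih c (Finset.mem_Iio.1 hc)]

/-- Formally this is `[∂^(b+e_i), x_i] = ∂^(b)`. Since `∂^(b)` need not descend to the quotient, the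
identity is checked on monomials and concluded by uniqueness. -/
theorem taylorCoeff_commutator (φ : Module.End k (MvPolynomial (Fin n) k ⧸ I)) (i : Fin n)
    (b : Fin n →₀ ℕ) :
    taylorCoeff (φ * Algebra.lmul k _ (Ideal.Quotient.mk I (X i)) -
      Algebra.lmul k _ (Ideal.Quotient.mk I (X i)) * φ) b =
      taylorCoeff φ (b + Finsupp.single i 1) := by
  refine taylorCoeff_unique (s := fun b => taylorCoeff φ (b + Finsupp.single i 1)) (fun u => ?_) b
  have hX : (X i * monomial u 1 : MvPolynomial (Fin n) k) =
      monomial (u + Finsupp.single i 1) 1 := by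
    rw [X, monomial_mul, one_mul, add_comm]
  simp only [LinearMap.sub_apply, Module.End.mul_apply, Algebra.coe_lmul_eq_mul,
    LinearMap.mul_apply']
  rw [← map_mul, hX, apply_monomial_eq_sum, apply_monomial_eq_sum φ u, Finset.mul_sum]
  set T : (Fin n →₀ ℕ) → MvPolynomial (Fin n) k ⧸ I := fun c =>
    Ideal.Quotient.mk I (monomial (u + Finsupp.single i 1 - c) 1) * taylorCoeff φ c with hT
  have h1 : ∑ c ∈ Finset.Iic u, Ideal.Quotient.mk I (X i) * (multiChoose u c •
      (Ideal.Quotient.mk I (monomial (u - c) 1) * taylorCoeff φ c)) =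
      ∑ c ∈ Finset.Iic (u + Finsupp.single i 1), multiChoose u c • T c := by
    have hsub : Finset.Iic u ⊆ Finset.Iic (u + Finsupp.single i 1) :=
      Finset.Iic_subset_Iic.2 le_self_add
    rw [← Finset.sum_subset hsub fun c _ hc => by
      rw [multiChoose_eq_zero (by simpa using hc), zero_smul]]
    refine Finset.sum_congr rfl fun c hc => ?_
    rw [hT, mul_smul_comm, ← mul_assoc, ← map_mul, X, monomial_mul, one_mul,
      ← add_tsub_assoc_of_le (Finset.mem_Iic.1 hc), add_comm u]
  have h2 : ∑ c ∈ Finset.Iic u, multiChoose u c • (Ideal.Quotient.mk I (monomial (u - c) 1) *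
      taylorCoeff φ (c + Finsupp.single i 1)) =
      ∑ c ∈ (Finset.Iic u).map (addRightEmbedding (Finsupp.single i 1)),
        (multiChoose (u + Finsupp.single i 1) c • T c - multiChoose u c • T c) := by
    rw [Finset.sum_map]
    refine Finset.sum_congr rfl fun c _ => ?_
    rw [addRightEmbedding_apply, multiChoose_succ_succ, add_smul, add_sub_cancel_left, hT]
    simp only [add_tsub_add_eq_tsub_right]
  rw [h1, h2, ← Finset.sum_sub_distrib]
  symm
  refine Finset.sum_subset (fun c hc => ?_) fun c hc hc' => ?_
  · obtain ⟨c, hcu, rfl⟩ := Finset.mem_map.1 hc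
    rw [addRightEmbedding_apply]
    exact Finset.mem_Iic.2 (add_le_add_left (Finset.mem_Iic.1 hcu) _)
  · have : c i = 0 := by
      by_contra hi
      refine hc' (Finset.mem_map.2 ⟨c - Finsupp.single i 1, ?_, tsub_add_cancel_of_le ?_⟩)
      · exact Finset.mem_Iic.2 (tsub_le_iff_right.2 (Finset.mem_Iic.1 hc))
      · rw [Finsupp.single_le_iff]
        omega
    rw [multiChoose_succ_of_eq_zero u this, sub_self]

theorem taylorCoeff_lmul (a : MvPolynomial (Fin n) k ⧸ I) (b : Fin n →₀ ℕ) :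
    taylorCoeff (Algebra.lmul k _ a) b = if b = 0 then a else 0 := by
  refine taylorCoeff_unique (s := fun b => if b = 0 then a else 0) (fun u => ?_) b
  rw [Finset.sum_eq_single_of_mem 0 (by simp) fun c _ hc => by simp [hc]]
  simp [multiChoose_zero, mul_comm]

/-- Each commutator lowers the order by one and shifts the coefficients by one. -/
theorem IsDiffOp.taylorCoeff_eq_zero {m : ℕ} {φ : Module.End k (MvPolynomial (Fin n) k ⧸ I)}
    (h : IsDiffOp k _ m φ) {b : Fin n →₀ ℕ} (hb : m < b.degree) : taylorCoeff φ b = 0 := by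
  induction m generalizing φ b with
  | zero =>
    obtain ⟨a, rfl⟩ := h
    rw [taylorCoeff_lmul, if_neg]
    rintro rfl
    simp at hb
  | succ m ih =>
    obtain ⟨i, hi⟩ : ∃ i, b i ≠ 0 := by
      by_contra! hc
      have : b = 0 := Finsupp.ext hc
      simp [this] at hb
    obtain ⟨b, rfl⟩ : ∃ b', b = b' + Finsupp.single i 1 :=
      ⟨_, (tsub_add_cancel_of_le (by rw [Finsupp.single_le_iff]; omega)).symm⟩
    rw [← taylorCoeff_commutator]
    exact ih (h _) (by simpa using hb)

/-- The Taylor expansion of a differential operator. -/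
theorem IsDiffOp.exists_taylor {m : ℕ} {φ : Module.End k (MvPolynomial (Fin n) k ⧸ I)}
    (h : IsDiffOp k _ m φ) : ∃ T : Finset (Fin n →₀ ℕ), ∀ f, φ (Ideal.Quotient.mk I f) =
      ∑ b ∈ T, taylorCoeff φ b * Ideal.Quotient.mk I (monoOp k 0 b f) := by
  obtain ⟨T, hT⟩ : ∃ T : Finset (Fin n →₀ ℕ), ∀ b ∉ T, taylorCoeff φ b = 0 := by
    -- The box `[0, m]^n` contains every `b` of degree at most `m`.
    refine ⟨Finset.Iic (Finsupp.equivFunOnFinite.symm fun _ => m), fun b hb => ?_⟩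
    refine h.taylorCoeff_eq_zero ?_
    by_contra! hle
    exact hb (Finset.mem_Iic.2 fun i => (Finsupp.le_degree i b).trans hle)
  refine ⟨T, fun f => ?_⟩
  induction f using MvPolynomial.induction_on' with
  | monomial u c =>
    have hc (v : Fin n →₀ ℕ) (d : k) : Ideal.Quotient.mk I (monomial v (d * c)) =
        c • Ideal.Quotient.mk I (monomial v d) := by
      rw [mul_comm, ← smul_eq_mul, ← smul_monomial]
      rfl
    have hc1 := hc u 1
    rw [one_mul] at hc1
    rw [hc1, map_smul, apply_monomial_eq_sum, Finset.smul_sum]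
    classical
    refine (Finset.sum_subset (Finset.subset_union_left (s₂ := T)) fun b _ hb => ?_).trans
      (Eq.trans ?_ (Finset.sum_subset (Finset.subset_union_right (s₁ := Finset.Iic u))
        fun b _ hb => ?_).symm)
    · rw [multiChoose_eq_zero (by simpa using hb), zero_smul, smul_zero]
    swap
    · rw [hT b hb, zero_mul]
    refine Finset.sum_congr rfl fun b _ => ?_
    rw [monoOp_monomial, hc, add_zero, mul_smul_comm]
    congr 1
    have : monomial (u - b) (multiChoose u b : k) =
        multiChoose u b • (monomial (u - b) 1 : MvPolynomial (Fin n) k) := by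
      rw [← map_nsmul, nsmul_one]
    rw [this, map_nsmul, mul_smul_comm, mul_comm]
  | add f g hf hg => simp only [map_add, hf, hg, mul_add, Finset.sum_add_distrib]

end quotient

/-! ### Faces and face ideals -/

theorem IsFace.mono {K : PreAbstractSimplicialComplex (Fin n)} {s t : Finset (Fin n)}
    (ht : IsFace K t) (hst : s ⊆ t) : IsFace K s := by
  rcases s.eq_empty_or_nonempty with rfl | hs
  · exact Or.inl rfl
  rcases ht with rfl | ht
  · exact Or.inl (Finset.subset_empty.1 hst)
  · exact Or.inr ((K.isRelLowerSet_faces ht).2 hst hs)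

theorem isFace_star_iff {K : PreAbstractSimplicialComplex (Fin n)} {σ : Finset (Fin n)}
    (hσ : IsFace K σ) (s : Finset (Fin n)) : IsFace (star σ K) s ↔ IsFace K (s ∪ σ) := by
  rcases s.eq_empty_or_nonempty with rfl | hs
  · simpa [IsFace] using hσ
  have hne : ¬ (s ∪ σ = ∅) := (hs.mono Finset.subset_union_left).ne_empty
  refine ⟨?_, fun h => ?_⟩
  · rintro (h | h)
    · exact absurd h hs.ne_empty
    · exact Or.inr h.2
  · have h' := h.mono (Finset.subset_union_left (s₁ := s))
    exact Or.inr ⟨h'.resolve_left hs.ne_empty, h.resolve_left hne⟩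

/-- Every face lies in a facet. -/
theorem IsFace.exists_facet {K : PreAbstractSimplicialComplex (Fin n)} {s : Finset (Fin n)}
    (hs : IsFace K s) :
    ∃ F, s ⊆ F ∧ IsFace K F ∧ ∀ i ∉ F, ¬ IsFace K (insert i F) := by
  obtain ⟨F, hsF, hF⟩ := Set.Finite.exists_le_maximal (Set.toFinite {t | IsFace K t}) hs
  refine ⟨F, hsF, hF.prop, fun i hi h => hi ?_⟩
  exact hF.le_of_ge h (Finset.subset_insert i F) (Finset.mem_insert_self i F)

theorem prod_X_eq_monomial (s : Finset (Fin n)) :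
    ∏ i ∈ s, (X i : MvPolynomial (Fin n) k) = monomial (∑ i ∈ s, Finsupp.single i 1) 1 := by
  rw [monomial_sum_one]
  rfl

theorem sum_single_apply (s : Finset (Fin n)) (j : Fin n) :
    (∑ i ∈ s, Finsupp.single i 1 : Fin n →₀ ℕ) j = if j ∈ s then 1 else 0 := by
  simp [Finsupp.finsetSum_apply, Finsupp.single_apply]

theorem sum_single_le_iff (s : Finset (Fin n)) (u : Fin n →₀ ℕ) :
    ∑ i ∈ s, Finsupp.single i 1 ≤ u ↔ s ⊆ u.support := by
  constructor
  · intro h i hi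
    have := h i
    rw [sum_single_apply, if_pos hi] at this
    rw [Finsupp.mem_support_iff]
    omega
  · intro h i
    rw [sum_single_apply]
    split_ifs with hi
    · exact Nat.one_le_iff_ne_zero.2 (Finsupp.mem_support_iff.1 (h hi))
    · exact Nat.zero_le _

/-- The face ideal consists of the polynomials all of whose monomials are supported on
non-faces. -/
theorem mem_faceIdeal_iff {K : PreAbstractSimplicialComplex (Fin n)}
    {f : MvPolynomial (Fin n) k} :
    f ∈ faceIdeal k K ↔ ∀ u ∈ f.support, ¬ IsFace K u.support := by
  have e : {f : MvPolynomial (Fin n) k | ∃ s : Finset (Fin n), ¬ IsFace K s ∧ f = ∏ i ∈ s, X i} =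
      (fun u => monomial u 1) ''
        ((fun s : Finset (Fin n) => ∑ i ∈ s, Finsupp.single i 1) '' {s | ¬ IsFace K s}) := by
    ext f
    simp only [Set.mem_ofPred_eq, Set.mem_image, exists_exists_and_eq_and, prod_X_eq_monomial,
      eq_comm (a := f)]
  rw [faceIdeal, e, mem_ideal_span_monomial_image]
  refine forall₂_congr fun u _ => ?_
  simp only [Set.exists_mem_image, Set.mem_ofPred_eq, sum_single_le_iff]
  exact ⟨fun ⟨s, hs, h⟩ hu => hs (hu.mono h), fun h => ⟨_, h, subset_rfl⟩⟩

theorem monomial_mem_faceIdeal {K : PreAbstractSimplicialComplex (Fin n)} {u : Fin n →₀ ℕ}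
    (hu : ¬ IsFace K u.support) (c : k) : monomial u c ∈ faceIdeal k K := by
  classical
  rw [mem_faceIdeal_iff]
  intro v hv
  rwa [Finset.mem_singleton.1 (support_monomial_subset hv)]

theorem add_mem_support_monomial_mul {f : MvPolynomial (Fin n) k} {u v : Fin n →₀ ℕ}
    (hu : u ∈ f.support) : v + u ∈ (monomial v 1 * f).support := by
  rw [mem_support_iff, coeff_monomial_mul, one_mul]
  exact mem_support_iff.1 hu

/-! ### Differential operators preserve the minimal primes -/

/-- The ideal generated by the variables outside a facet is preserved by every differential
operator on the face ring. -/
theorem IsDiffOp.apply_mem_of_facet {K : PreAbstractSimplicialComplex (Fin n)}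
    {F : Finset (Fin n)} (hF : ∀ i ∉ F, ¬ IsFace K (insert i F)) {m : ℕ}
    {φ : Module.End k (FaceRing k K)} (hφ : IsDiffOp k _ m φ) {f g : MvPolynomial (Fin n) k}
    (hf : f ∈ Ideal.span (X '' {i | i ∉ F}))
    (h : φ (Ideal.Quotient.mk _ f) = Ideal.Quotient.mk _ g)
    (hI : faceIdeal k K ≤ Ideal.span (X '' {i | i ∉ F})) :
    g ∈ Ideal.span (X '' {i | i ∉ F}) := by
  induction m generalizing φ g with
  | zero =>
    obtain ⟨a, rfl⟩ := hφ
    obtain ⟨a, rfl⟩ := Ideal.Quotient.mk_surjective a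
    have h' : Ideal.Quotient.mk (faceIdeal k K) (a * f) = Ideal.Quotient.mk _ g := by
      rw [← h]; simp
    have := hI (Ideal.Quotient.eq.1 h')
    rw [← sub_sub_cancel (a * f) g]
    exact sub_mem (Ideal.mul_mem_left _ _ hf) this
  | succ m ih =>
    set xF : MvPolynomial (Fin n) k := ∏ i ∈ F, X i with hxF
    -- `F ∪ {i}` is a non-face for `i ∉ F`, so `x_F` annihilates the ideal in the face ring.
    have h0 : Ideal.Quotient.mk (faceIdeal k K) (xF * f) = 0 := by
      rw [Ideal.Quotient.eq_zero_iff_mem, mul_comm]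
      refine Submodule.span_induction (p := fun f _ => f * xF ∈ faceIdeal k K) ?_ (by simp) ?_ ?_ hf
      · rintro _ ⟨i, hi, rfl⟩
        refine Ideal.subset_span ⟨insert i F, hF i hi, ?_⟩
        rw [Finset.prod_insert hi]
      · intro f g _ _ hf hg
        rw [add_mul]
        exact add_mem hf hg
      · intro a f _ hf
        rw [smul_mul_assoc]
        exact Ideal.mul_mem_left _ _ hf
    -- As `x_F f = 0` in the face ring, `[φ, x_F]` maps `f` to `-x_F φ(f)`. Afterwards `x_F` is
    -- cancelled: multiplying by it changes no exponent outside `F`.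
    have key := ih (g := -(xF * g)) (hφ (Ideal.Quotient.mk _ xF)) (by
      simp only [LinearMap.sub_apply, Module.End.mul_apply, Algebra.coe_lmul_eq_mul,
        LinearMap.mul_apply']
      rw [← map_mul, h0, h, map_zero, zero_sub, ← map_mul, map_neg])
    rw [neg_mem_iff, hxF, prod_X_eq_monomial, mem_ideal_span_X_image] at key
    rw [mem_ideal_span_X_image]
    intro u hu
    obtain ⟨i, hi, hne⟩ := key _ (add_mem_support_monomial_mul hu)
    refine ⟨i, hi, ?_⟩
    rwa [Finsupp.add_apply, sum_single_apply, if_neg hi, zero_add] at hne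

theorem faceIdeal_le_span_X {K : PreAbstractSimplicialComplex (Fin n)} {F : Finset (Fin n)}
    (hF : IsFace K F) : faceIdeal k K ≤ Ideal.span (X '' {i | i ∉ F}) := by
  refine Ideal.span_le.2 ?_
  rintro _ ⟨s, hs, rfl⟩
  obtain ⟨i, his, hi⟩ : ∃ i ∈ s, i ∉ F := by
    by_contra! hc
    exact hs (hF.mono hc)
  exact Ideal.mem_of_dvd _ (Finset.dvd_prod_of_mem _ his)
    (Ideal.subset_span (Set.mem_image_of_mem _ hi))

/-- In the recursion for the coefficient, `φ(x^b)` lies in the preserved ideal. For `c < b`, either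
`c` leaves `F` and induction applies, or `b - c` does and `x^(b-c)` lies in the ideal. -/
theorem IsDiffOp.taylorCoeff_mem {K : PreAbstractSimplicialComplex (Fin n)}
    {F : Finset (Fin n)} (hKF : IsFace K F) (hF : ∀ i ∉ F, ¬ IsFace K (insert i F)) {m : ℕ}
    {φ : Module.End k (FaceRing k K)} (hφ : IsDiffOp k _ m φ) {b : Fin n →₀ ℕ}
    (hb : ¬ b.support ⊆ F) :
    taylorCoeff φ b ∈ (Ideal.span (X '' {i | i ∉ F})).map (Ideal.Quotient.mk (faceIdeal k K)) := by
  have hI := faceIdeal_le_span_X (k := k) hKF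
  have hmon (u : Fin n →₀ ℕ) (hu : ¬ u.support ⊆ F) :
      (monomial u 1 : MvPolynomial (Fin n) k) ∈ Ideal.span (X '' {i | i ∉ F}) := by
    classical
    obtain ⟨i, hiu, hi⟩ := Finset.not_subset.1 hu
    rw [mem_ideal_span_X_image]
    intro v hv
    rw [Finset.mem_singleton.1 (support_monomial_subset hv)]
    exact ⟨i, hi, Finsupp.mem_support_iff.1 hiu⟩
  induction b using WellFoundedLT.induction with
  | ind b ih =>
    rw [taylorCoeff_eq]
    refine sub_mem ?_ (sum_mem fun c hc => nsmul_mem ?_ _)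
    · obtain ⟨g, hg⟩ := Ideal.Quotient.mk_surjective (φ (Ideal.Quotient.mk _ (monomial b 1)))
      rw [← hg, Ideal.mem_quotient_iff_mem hI]
      exact hφ.apply_mem_of_facet hF (hmon b hb) hg.symm hI
    · by_cases hcF : c.support ⊆ F
      · refine Ideal.mul_mem_right _ _ (Ideal.mem_map_of_mem _ (hmon _ fun hs => hb ?_))
        intro i hi
        by_contra hiF
        have h1 := Finsupp.notMem_support_iff.1 fun h => hiF (hs h)
        have h2 := Finsupp.notMem_support_iff.1 fun h => hiF (hcF h)
        rw [Finsupp.tsub_apply] at h1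
        exact Finsupp.mem_support_iff.1 hi (by omega)
      · exact Ideal.mul_mem_left _ _ (ih c (Finset.mem_Iio.1 hc) hcF)

theorem mul_taylorCoeff_eq_zero {I : Ideal (MvPolynomial (Fin n) k)}
    {φ : Module.End k (MvPolynomial (Fin n) k ⧸ I)} {a : MvPolynomial (Fin n) k ⧸ I}
    (h : ∀ x, a * φ x = 0) (b : Fin n →₀ ℕ) : a * taylorCoeff φ b = 0 := by
  induction b using WellFoundedLT.induction with
  | ind b ih =>
    rw [taylorCoeff_eq, mul_sub, h, zero_sub, neg_eq_zero, Finset.mul_sum]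
    refine Finset.sum_eq_zero fun c hc => ?_
    rw [mul_smul_comm, mul_left_comm, ih c (Finset.mem_Iio.1 hc), mul_zero, smul_zero]

/-! ### Monomial operators on the face ring -/

/-- Every face containing `s` spans a face together with `t`. -/
def StarLE (K : PreAbstractSimplicialComplex (Fin n)) (s t : Finset (Fin n)) : Prop :=
  ∀ G, IsFace K G → s ⊆ G → IsFace K (G ∪ t)

/-- If `supp (u - b + p)` is a face, it contains `supp p`, so adjoining `supp b` gives a face
containing `supp u`. Hence non-faces go to non-faces or to zero. -/
theorem exists_diffOp_isInducedBy (k : Type*) [CommRing k]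
    {K : PreAbstractSimplicialComplex (Fin n)} {p b : Fin n →₀ ℕ}
    (h : StarLE K p.support b.support) :
    ∃ φ : diffOp k (FaceRing k K), IsInducedBy φ.1 (monoOp k p b) := by
  have hI : ∀ f ∈ faceIdeal k K, monoOp k p b f ∈ faceIdeal k K := by
    intro f hf
    rw [f.as_sum, map_sum]
    refine sum_mem fun u hu => ?_
    rw [monoOp_monomial]
    by_cases hbu : b ≤ u
    · refine monomial_mem_faceIdeal (fun hface => ?_) _
      refine mem_faceIdeal_iff.1 hf u hu ((h _ hface ?_).mono fun i hi => ?_)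
      · intro i hi
        rw [Finsupp.mem_support_iff] at hi ⊢
        rw [Finsupp.add_apply]
        omega
      · rw [Finset.mem_union, Finsupp.mem_support_iff, Finsupp.mem_support_iff,
          Finsupp.add_apply, Finsupp.tsub_apply]
        rw [Finsupp.mem_support_iff] at hi
        omega
    · simp [multiChoose_eq_zero hbu]
  obtain ⟨φ, hφ⟩ := exists_isInducedBy hI
  exact ⟨⟨φ, _, hφ.isDiffOp⟩, hφ⟩

/-- The operator `x^p ∂^(b)` lies in the extension of an ideal that contains the square-free
monomial supported on `p`. -/
theorem exists_mem_extension_isInducedBy {K : PreAbstractSimplicialComplex (Fin n)}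
    {J : Ideal (FaceRing k K)} {p b : Fin n →₀ ℕ} (h : StarLE K p.support b.support)
    (hJ : faceMonomial k K p.support ∈ J) :
    ∃ φ ∈ extension k J, IsInducedBy φ.1 (monoOp k p b) := by
  set A := p.support with hA
  -- `C` collects the indices of `A` at which the exponent 1 is still allowed.
  suffices H : ∀ C : Finset (Fin n), ∀ p b : Fin n →₀ ℕ, p.support = A →
      StarLE K A b.support → (∀ i ∈ A, i ∉ C → 2 ≤ p i) →
      ∃ φ ∈ extension k J, IsInducedBy φ.1 (monoOp k p b) from
    H A p b hA.symm h fun i hi hi' => absurd hi hi'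
  intro C
  induction C using Finset.induction_on with
  | empty =>
    intro p b hp hb hp2
    have hle : ∑ i ∈ A, Finsupp.single i 1 ≤ p := (sum_single_le_iff _ _).2 hp.ge
    obtain ⟨q, rfl⟩ := exists_add_of_le hle
    have hq : q.support = A := by
      ext i
      by_cases hi : i ∈ A
      · have := hp2 i hi (Finset.notMem_empty i)
        rw [Finsupp.add_apply, sum_single_apply, if_pos hi] at this
        simp only [hi, iff_true, Finsupp.mem_support_iff]
        omega
      · have := Finsupp.notMem_support_iff.1 (hp ▸ hi)
        rw [Finsupp.add_apply, sum_single_apply, if_neg hi] at this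
        simp only [hi, iff_false, Finsupp.mem_support_iff]
        omega
    -- Exponents at least 2 leave `q = p - 1_A` with support `A`, so `x^q ∂^(b)` still descends.
    obtain ⟨φ, hφ⟩ := exists_diffOp_isInducedBy k (p := q) (b := b) (hq ▸ hb)
    refine ⟨toDiffOp k (faceMonomial k K A) * φ, TwoSidedIdeal.mul_mem_right _ _ _
      (TwoSidedIdeal.subset_span (Set.mem_image_of_mem _ hJ)), fun f => ?_⟩
    rw [monoOp_add_left, map_mul, ← hφ, ← prod_X_eq_monomial]
    rfl
  | insert i C hi ih =>
    intro p b hp hb hp2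
    by_cases hip : i ∈ A ∧ p i < 2
    · obtain ⟨hiA, hlt⟩ := hip
      have hp1 : p i = 1 := by
        have : p i ≠ 0 := Finsupp.mem_support_iff.1 (hp ▸ hiA)
        omega
      have hsupp (m : ℕ) : (p + Finsupp.single i m).support = A := by
        rw [← hp]
        ext j
        rcases eq_or_ne j i with rfl | hj
        · simp [hp1]
        · simp [hj]
      have hge (m : ℕ) (hm : 1 ≤ m) : ∀ j ∈ A, j ∉ C → 2 ≤ (p + Finsupp.single i m) j := by
        intro j hj hjC
        rcases eq_or_ne j i with rfl | hji
        · simp [hp1]; omega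
        · rw [add_single_apply_of_ne _ _ hji]
          exact hp2 j hj (by simp [hji, hjC])
      -- Raising `b` at `i` costs nothing, since any face containing `A` already contains `i`.
      have hstar (m : ℕ) : StarLE K A (b + Finsupp.single i m).support := by
        intro G hG hAG
        refine (hb G hG hAG).mono fun j hj => ?_
        rcases eq_or_ne j i with rfl | hji
        · exact Finset.mem_union_left _ (hAG hiA)
        · simpa [hji] using hj
      obtain ⟨ε, hε⟩ := exists_diffOp_isInducedBy k (K := K) (p := Finsupp.single i 1)
        (b := Finsupp.single i 2) (by
          intro G hG hi
          rw [Finsupp.support_single i one_ne_zero] at hi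
          rw [Finsupp.support_single i two_ne_zero, Finset.union_eq_left.2 hi]
          exact hG)
      obtain ⟨φ₀, hφ₀, h₀⟩ := ih _ b (hsupp 1) hb (hge 1 le_rfl)
      obtain ⟨φ₁, hφ₁, h₁⟩ := ih _ _ (hsupp 1) (hstar 1) (hge 1 le_rfl)
      obtain ⟨φ₂, hφ₂, h₂⟩ := ih _ _ (hsupp 2) (hstar 2) (hge 2 one_le_two)
      refine ⟨ε * φ₀ - (b i + 2).choose 2 • φ₂ - (2 * (b i + 1)) • φ₁,
        sub_mem (sub_mem (TwoSidedIdeal.mul_mem_left _ _ _ hφ₀) (nsmul_mem hφ₂ _))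
          (nsmul_mem hφ₁ _), fun f => ?_⟩
      have h := congrArg (Ideal.Quotient.mk (faceIdeal k K)) (monoOp_comp_eq p b hp1 f)
      rw [← hε, ← h₀, map_add, map_add, map_nsmul, map_nsmul, ← h₁, ← h₂] at h
      rw [← sub_eq_iff_eq_add', ← sub_sub] at h
      exact h
    · refine ih p b hp hb fun j hj hjC => ?_
      rcases eq_or_ne j i with rfl | hji
      · by_contra hlt
        exact hip ⟨hj, by omega⟩
      · exact hp2 j hj (by simp [hji, hjC])

/-! ### Comparison of the kernel with the extension -/

/-- The elements of the kernel of the localization map are annihilated by a power of the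
inverted element. -/
theorem exists_pow_mul_eq_zero_of_mem_ker {A : Type*} [CommRing A] [Algebra k A] {f : A}
    {φ : diffOp k A} (h : localizationMap k f φ = 0) :
    ∃ N : ℕ, ∀ x, f ^ N * φ.1 x = 0 := by
  have h' : OreLocalization.oreDiv φ (1 : Submonoid.powers (toDiffOp k f)) =
      OreLocalization.oreDiv 0 (1 : Submonoid.powers (toDiffOp k f)) :=
    h.trans (OreLocalization.zero_oreDiv _).symm
  obtain ⟨⟨_, N, rfl⟩, v, h1, h2⟩ := OreLocalization.oreDiv_eq_iff.1 h'
  refine ⟨N, fun x => ?_⟩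
  have hv : toDiffOp k f ^ N = v := by simpa [Submonoid.smul_def] using h2
  rw [← hv, Submonoid.smul_def, smul_zero, smul_eq_mul, ← map_pow] at h1
  exact (LinearMap.congr_fun (congrArg Subtype.val h1) x).symm

/-- An element annihilated by `f` dies once `f` becomes a unit. -/
theorem extension_le_ker {A : Type*} [CommRing A] [Algebra k A] {f : A} {J : Ideal A}
    (h : ∀ a ∈ J, f * a = 0) :
    extension k J ≤ TwoSidedIdeal.ker (localizationMap k f) := by
  rw [extension, TwoSidedIdeal.span_le]
  rintro _ ⟨a, ha, rfl⟩
  rw [SetLike.mem_coe, TwoSidedIdeal.mem_ker]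
  have hu : IsUnit (localizationMap k f (toDiffOp k f)) :=
    OreLocalization.numerator_isUnit ⟨toDiffOp k f, Submonoid.mem_powers _⟩
  rw [← hu.mul_right_eq_zero, ← map_mul, ← map_mul, h a ha, map_zero, map_zero]

theorem faceMonomial_mul_eq_zero {K : PreAbstractSimplicialComplex (Fin n)} {σ : Finset (Fin n)}
    (hσ : IsFace K σ) {a : FaceRing k K} (ha : a ∈ subcomplexIdeal k K (star σ K)) :
    faceMonomial k K σ * a = 0 := by
  obtain ⟨f, hf, rfl⟩ := (Ideal.mem_map_iff_of_surjective _ Ideal.Quotient.mk_surjective).1 ha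
  rw [faceMonomial, ← map_mul, Ideal.Quotient.eq_zero_iff_mem, prod_X_eq_monomial, f.as_sum,
    Finset.mul_sum]
  refine sum_mem fun u hu => ?_
  rw [monomial_mul]
  refine monomial_mem_faceIdeal (fun h => ?_) _
  refine mem_faceIdeal_iff.1 hf u hu ((isFace_star_iff hσ _).2 (h.mono fun i hi => ?_))
  rw [Finsupp.mem_support_iff, Finsupp.add_apply, sum_single_apply]
  rcases Finset.mem_union.1 hi with hi | hi
  · have := Finsupp.mem_support_iff.1 hi
    omega
  · rw [if_pos hi]
    omega

/-- Enlarge `G` to a facet `F`. If `supp b` left `F`, the coefficient would lie in `P_F`, forcing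
`u` to involve a variable outside `F`, although `supp u ⊆ G ⊆ F`. -/
theorem IsDiffOp.starLE_of_mem_support {K : PreAbstractSimplicialComplex (Fin n)} {m : ℕ}
    {φ : Module.End k (FaceRing k K)} (hφ : IsDiffOp k _ m φ) {b : Fin n →₀ ℕ}
    {r : MvPolynomial (Fin n) k} (hr : Ideal.Quotient.mk _ r = taylorCoeff φ b)
    {u : Fin n →₀ ℕ} (hu : u ∈ r.support) : StarLE K u.support b.support := by
  intro G hG huG
  obtain ⟨F, hGF, hKF, hF⟩ := hG.exists_facet
  refine hKF.mono (Finset.union_subset hGF ?_)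
  by_contra hb
  have h := hφ.taylorCoeff_mem hKF hF hb
  rw [← hr, Ideal.mem_quotient_iff_mem (faceIdeal_le_span_X hKF), mem_ideal_span_X_image] at h
  obtain ⟨i, hi, hne⟩ := h u hu
  exact hi (hGF (huG (Finsupp.mem_support_iff.2 hne)))

/-- Membership in `I_K` is tested monomial by monomial, and `x_σ^N x^u` has support inside `supp u ∪
σ`. -/
theorem not_isFace_union_of_pow_mul_eq_zero {K : PreAbstractSimplicialComplex (Fin n)}
    {σ : Finset (Fin n)} {N : ℕ} {r : MvPolynomial (Fin n) k}
    (h : faceMonomial k K σ ^ N * Ideal.Quotient.mk _ r = 0) {u : Fin n →₀ ℕ}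
    (hu : u ∈ r.support) : ¬ IsFace K (u.support ∪ σ) := by
  rw [faceMonomial, ← map_pow, ← map_mul, Ideal.Quotient.eq_zero_iff_mem, prod_X_eq_monomial,
    monomial_pow, one_pow, mem_faceIdeal_iff] at h
  refine fun hface => h _ (add_mem_support_monomial_mul hu) (hface.mono fun i hi => ?_)
  by_contra hi'
  rw [Finset.mem_union, not_or, Finsupp.notMem_support_iff] at hi'
  refine Finsupp.mem_support_iff.1 hi ?_
  rw [Finsupp.add_apply, Finsupp.smul_apply, sum_single_apply, if_neg hi'.2, hi'.1, smul_zero, add_zero]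

theorem ker_le_extension {K : PreAbstractSimplicialComplex (Fin n)} {σ : Finset (Fin n)}
    (hσ : IsFace K σ) :
    TwoSidedIdeal.ker (localizationMap k (faceMonomial k K σ)) ≤
      extension k (subcomplexIdeal k K (star σ K)) := by
  intro φ hφ
  rw [TwoSidedIdeal.mem_ker] at hφ
  obtain ⟨N, hN⟩ := exists_pow_mul_eq_zero_of_mem_ker hφ
  obtain ⟨m, hm⟩ := φ.2
  obtain ⟨T, hT⟩ := hm.exists_taylor
  choose r hr using fun b => Ideal.Quotient.mk_surjective (taylorCoeff φ.1 b)
  have key (b u : Fin n →₀ ℕ) (hu : u ∈ (r b).support) :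
      ∃ ψ ∈ extension k (subcomplexIdeal k K (star σ K)), IsInducedBy ψ.1 (monoOp k u b) := by
    refine exists_mem_extension_isInducedBy (hm.starLE_of_mem_support (hr b) hu) ?_
    refine Ideal.mem_map_of_mem _ (Ideal.subset_span ⟨u.support, ?_, rfl⟩)
    rw [isFace_star_iff hσ]
    refine not_isFace_union_of_pow_mul_eq_zero (k := k) (r := r b) (N := N) ?_ hu
    rw [hr, mul_taylorCoeff_eq_zero hN]
  have : Nonempty (diffOp k (FaceRing k K)) := ⟨0⟩
  choose! ψ hψ hψ' using key
  -- The Taylor expansion, split into monomials: each `x^u ∂^(b)` is now an operator on the face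
  -- ring lying in the extension, although `∂^(b)` alone need not descend.
  have e : φ = ∑ b ∈ T, ∑ u ∈ (r b).support,
      toDiffOp k (Ideal.Quotient.mk _ (C ((r b).coeff u))) * ψ b u := by
    refine Subtype.ext (LinearMap.ext fun x => ?_)
    obtain ⟨f, rfl⟩ := Ideal.Quotient.mk_surjective x
    rw [hT]
    simp only [AddSubmonoidClass.coe_finsetSum, LinearMap.sum_apply]
    refine Finset.sum_congr rfl fun b _ => ?_
    rw [← hr, ← map_mul]
    conv_lhs => rw [(r b).as_sum, Finset.sum_mul, map_sum]
    refine Finset.sum_congr rfl fun u hu => ?_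
    have h : monomial u ((r b).coeff u) * monoOp k 0 b f =
        C ((r b).coeff u) * monoOp k u b f := by
      rw [← add_zero u, monoOp_add_left, add_zero, ← mul_assoc, C_mul_monomial, mul_one]
    rw [h, map_mul, ← hψ' b u hu]
    rfl
  rw [e]
  exact sum_mem fun b _ => sum_mem fun u hu => TwoSidedIdeal.mul_mem_left _ _ _ (hψ b u hu)

end StanleyReisner

end

theorem mainTheorem4 (k : Type*) [CommRing k] [IsDomain k] (n : ℕ)
    (K : PreAbstractSimplicialComplex (Fin n)) (σ : Finset (Fin n))
    (hσ : StanleyReisner.IsFace K σ) :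
    TwoSidedIdeal.ker
        (StanleyReisner.localizationMap k (StanleyReisner.faceMonomial k K σ)) =
      StanleyReisner.extension k
        (StanleyReisner.subcomplexIdeal k K (StanleyReisner.star σ K)) :=
  le_antisymm (StanleyReisner.ker_le_extension hσ)
    (StanleyReisner.extension_le_ker fun _ => StanleyReisner.faceMonomial_mul_eq_zero hσ)
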